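/- Work in the vocabulary of graphs, with one binary relation symbol $E$. For $k\in\mathbb N$ let $L^k_{\infty\omega}$ be the set of formulas built from the atomic formulas $x_i=x_j$ and $E(x_i,x_j)$ with $1\le i,j\le k$ by negation, the quantifiers $\exists x_i,\forall x_i$ $(1\le i\le k)$, and conjunctions and disjunctions of arbitrary, possibly infinite, families of such formulas, and let $L^\omega_{\infty\omega}=\bigcup_k L^k_{\infty\omega}$. Let $\varphi(P,v_1,\dots,v_r,v_{r+1},\dots,v_s)$ be a first-order formula in the vocabulary $\{E,P\}$ in which the $r$-ary predicate $P$ occurs only positively. For a directed graph $G$ and parameters $a=(a_{r+1},\dots,a_s)$ from $G$ put $P_0=\emptyset$ and $P_{i+1}=\{(v_1,\dots,v_r) : G\models\varphi(P_i,v_1,\dots,v_r,a_{r+1},\dots,a_s)\}$. A class $\mathcal F$ of finite directed graphs \emph{admits unbounded fixed points} if for some such $\varphi$ there is no $j\in\mathbb N$ such that $P_j=\bigcup_i P_i$ for all $G\in\mathcal F$ and all parameters $a$ from $G$. \textbf{Statement.} For every countable set $\mathcal L$ of $L^\omega_{\infty\omega}$-formulas about graphs there is a class $\mathcal F$, closed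 under isomorphism, of finite nonempty directed graphs without loops that admits unbounded fixed points and such that for every formula $\varphi\in\mathcal L$ there is a first-order formula $\psi$ in the vocabulary $\{E\}$ that is equivalent to $\varphi$ over $\mathcal F$: for every $G\in\mathcal F$ and every assignment of the variables in $G$, $G\models\varphi$ if and only if $G\models\psi$. -/

import Mathlib

open FirstOrder

universe u

namespace McColm

/-- A finite nonempty directed graph without loops. -/
structure FinDigraph where
  V : Type
  [fin : Finite V]
  [nonempty : Nonempty V]
  graph : Digraph V
  loopless : ∀ v, ¬ graph.Adj v v

attribute [instance] FinDigraph.fin FinDigraph.nonempty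

/-- A directed graph as a structure of the vocabulary with one binary relation symbol. -/
@[reducible]
def graphStructure {V : Type} (G : Digraph V) : Language.graph.Structure V where
  funMap f := f.elim
  RelMap | .adj => fun x => G.Adj (x 0) (x 1)

/-- `G` satisfies the first-order formula `ψ` about graphs under the assignment `v`. -/
def FOSat {V : Type} (G : Digraph V) {α : Type} (ψ : Language.graph.Formula α) (v : α → V) :
    Prop :=
  letI := graphStructure G
  ψ.Realize v

/-- A class of finite directed graphs is closed under isomorphism. -/
def IsoClosed (K : Set FinDigraph) : Prop :=
  ∀ G H : FinDigraph, G ∈ K → Nonempty (G.graph.Adj ≃r H.graph.Adj) → H ∈ K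

/-! ### Infinitary logic with finitely many variables -/

/-- The formulas of `L^k_{∞ω}` in the vocabulary of graphs: the only individual variables, free or
bound, are `x_i` for `i : Fin k`, and a variable may be quantified repeatedly. -/
inductive InfFormula (k : ℕ) : Type (u + 1)
  | equal (i j : Fin k) : InfFormula k
  | adj (i j : Fin k) : InfFormula k
  | neg (φ : InfFormula k) : InfFormula k
  | ex (i : Fin k) (φ : InfFormula k) : InfFormula k
  | all (i : Fin k) (φ : InfFormula k) : InfFormula k
  | disj {ι : Type u} (φ : ι → InfFormula k) : InfFormula k
  | conj {ι : Type u} (φ : ι → InfFormula k) : InfFormula k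

/-- Satisfaction of an infinitary formula under an assignment of all of its variables. -/
def InfFormula.Sat {V : Type} (G : Digraph V) {k : ℕ} : InfFormula.{u} k → (Fin k → V) → Prop
  | .equal i j, v => v i = v j
  | .adj i j, v => G.Adj (v i) (v j)
  | .neg φ, v => ¬ φ.Sat G v
  | .ex i φ, v => ∃ a : V, φ.Sat G (Function.update v i a)
  | .all i φ, v => ∀ a : V, φ.Sat G (Function.update v i a)
  | .disj φ, v => ∃ i, (φ i).Sat G v
  | .conj φ, v => ∀ i, (φ i).Sat G v

/-- The formulas of `L^ω_{∞ω}` in the vocabulary of graphs: each of them uses finitely many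
individual variables, that is, lies in `L^k_{∞ω}` for some `k`. -/
abbrev InfinitaryFormula : Type (u + 1) := Σ k : ℕ, InfFormula.{u} k

/-- Over the class `K`, the infinitary formula `φ` is equivalent to one first-order formula. -/
def EquivFirstOrder (K : Set FinDigraph) (φ : InfinitaryFormula.{u}) : Prop :=
  ∃ ψ : Language.graph.Formula (Fin φ.1), ∀ G ∈ K, ∀ v : Fin φ.1 → G.V,
    φ.2.Sat G.graph v ↔ FOSat G.graph ψ v

/-! ### Positive elementary inductions -/

/-- Relation symbols: the edge relation and one further `r`-ary symbol `P`. -/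
inductive IndRel (r : ℕ) : ℕ → Type
  | adj : IndRel r 2
  | P : IndRel r r

/-- The relation symbol is `P`, not the edge relation. -/
def IndRel.IsP {r n : ℕ} : IndRel r n → Prop
  | .adj => False
  | .P => True

/-- The vocabulary of graphs expanded by an `r`-ary relation symbol `P`. -/
def indLanguage (r : ℕ) : Language := ⟨fun _ => Empty, IndRel r⟩

/-- The expansion of a directed graph that interprets `P` by the given relation. -/
@[reducible]
def indStructure {V : Type} (G : Digraph V) {r : ℕ} (R : Set (Fin r → V)) :
    (indLanguage r).Structure V where
  funMap f := f.elim
  RelMap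
    | .adj => fun x => G.Adj (x 0) (x 1)
    | .P => fun x => x ∈ R

/-- All occurrences of `P` in the formula are positive (for `true`), or all of them are negative
(for `false`). -/
def Polarity {r : ℕ} {α : Type} : Bool → ∀ {n : ℕ}, (indLanguage r).BoundedFormula α n → Prop
  | _, _, .falsum => True
  | _, _, .equal _ _ => True
  | b, _, .rel R _ => IndRel.IsP R → b = true
  | b, _, .imp φ ψ => Polarity (!b) φ ∧ Polarity b ψ
  | b, _, .all φ => Polarity b φ

/-- A first-order formula `φ(P, v_1, …, v_r, a_1, …, a_p)` in which the `r`-ary predicate `P` occurs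
only positively. The variables `v` are those of the induction, the variables `a` are parameters. -/
structure PosInduction where
  r : ℕ
  p : ℕ
  formula : (indLanguage r).Formula (Fin r ⊕ Fin p)
  positive : Polarity true formula

/-- The stages `P_0 = ∅`, `P_{i+1} = {v | G ⊨ φ(P_i, v, a)}` of the induction. -/
def PosInduction.stage (φ : PosInduction) {V : Type} (G : Digraph V) (a : Fin φ.p → V) :
    ℕ → Set (Fin φ.r → V)
  | 0 => ∅
  | i + 1 => {v | letI := indStructure G (φ.stage G a i)
                  φ.formula.Realize (Sum.elim v a)}

/-- The induction closes after a number of stages that is bounded over the class `K`. -/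
def PosInduction.BoundedOn (φ : PosInduction) (K : Set FinDigraph) : Prop :=
  ∃ j : ℕ, ∀ G ∈ K, ∀ a : Fin φ.p → G.V, φ.stage G.graph a j = ⋃ i, φ.stage G.graph a i

/-- The class `K` admits unbounded fixed points: some positive elementary induction is not
bounded in `K`. -/
def AdmitsUnboundedFixedPoints (K : Set FinDigraph) : Prop :=
  ∃ φ : PosInduction, ¬ φ.BoundedOn K

end McColm

/-! Finite-variable infinitary logic cannot count beyond its number of variables, whereas a
first-order formula may use as many variables as it needs. Information stored in the multiplicities
of parallel edges, all at least `k`, is therefore invisible to `k` variables but readable in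
first-order logic. Subdividing every edge turns multigraphs into loopless digraphs.

Suppose `M` extends a finite multigraph `A` by at least `2k` vertices, with all new multiplicities
at least `k`. A back-and-forth argument (`Similar.exists_update`, `Similar.sat_iff`) shows that the
truth of a `k`-variable formula at a tuple depends only on the tuple's pattern and its endpoints in
`A`, whatever `M` is. So truth can be decided in one fixed extension, `completion`, and then written
into a further extension: `record` adds a vertex for each true tuple and codes its description in
multiplicities. Adding these vertices does not change what they record, and `sat_iff_isRecorded`
reads it off by a first-order formula.

The `n`-th graph starts from a path with `n + 1` vertices and records the first `n` formulas of an
enumeration, using increasing thresholds so that different stages do not interfere. Each formula is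
recorded in all but finitely many graphs, and these exceptions are described outright
(`equivFirstOrder_of_forall_gt`). The multiplicity 3 is reserved for the path edges, so an induction
along the path stays definable and needs unboundedly many stages. -/

namespace McColm

/-! ### Uniformly first-order definable relations on directed graphs -/

/-- A relation, given uniformly on all directed graphs, that a first-order formula defines. -/
def FODefinable {α : Type} (R : ∀ V : Type, Digraph V → (α → V) → Prop) : Prop :=
  ∃ ψ : Language.graph.Formula α, ∀ (V : Type) (G : Digraph V) (v : α → V),
    R V G v ↔ FOSat G ψ v

namespace FODefinable

variable {α β ι : Type} {R S : ∀ V : Type, Digraph V → (α → V) → Prop}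

theorem congr (hR : FODefinable R) (h : ∀ V G v, S V G v ↔ R V G v) : FODefinable S :=
  let ⟨ψ, hψ⟩ := hR
  ⟨ψ, fun V G v => (h V G v).trans (hψ V G v)⟩

theorem eq (a b : α) : FODefinable fun _ _ v => v a = v b := by
  refine ⟨Language.Term.equal (.var a) (.var b), fun V G v => ?_⟩
  let _ := graphStructure G
  simp [FOSat, Language.Formula.realize_equal]

theorem adj (a b : α) : FODefinable fun _ G v => G.Adj (v a) (v b) := by
  refine ⟨Language.Relations.formula₂ Language.adj (.var a) (.var b), fun V G v => ?_⟩
  let _ := graphStructure G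
  unfold FOSat
  rw [Language.Formula.realize_rel₂]
  rfl

theorem not (hR : FODefinable R) : FODefinable fun V G v => ¬ R V G v :=
  let ⟨ψ, hψ⟩ := hR
  ⟨ψ.not, fun V G v => not_congr (hψ V G v)⟩

theorem imp (hR : FODefinable R) (hS : FODefinable S) :
    FODefinable fun V G v => R V G v → S V G v :=
  let ⟨ψ, hψ⟩ := hR
  let ⟨χ, hχ⟩ := hS
  ⟨ψ.imp χ, fun V G v => imp_congr (hψ V G v) (hχ V G v)⟩

theorem or (hR : FODefinable R) (hS : FODefinable S) :
    FODefinable fun V G v => R V G v ∨ S V G v :=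
  (hR.not.imp hS).congr fun _ _ _ => or_iff_not_imp_left

theorem and (hR : FODefinable R) (hS : FODefinable S) :
    FODefinable fun V G v => R V G v ∧ S V G v :=
  (hR.imp hS.not).not.congr fun _ _ _ => by tauto

theorem iff (hR : FODefinable R) (hS : FODefinable S) :
    FODefinable fun V G v => R V G v ↔ S V G v :=
  ((hR.imp hS).and (hS.imp hR)).congr fun _ _ _ => iff_iff_implies_and_implies

theorem const (p : Prop) : FODefinable (α := α) fun _ _ _ => p := by
  by_cases hp : p
  · exact ⟨⊤, fun V G v => by
      let _ := graphStructure G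
      simp [FOSat, hp]⟩
  · exact ⟨⊥, fun V G v => by
      let _ := graphStructure G
      simp [FOSat, hp]⟩

theorem iAnd [Finite ι] {R : ι → ∀ V : Type, Digraph V → (α → V) → Prop}
    (hR : ∀ i, FODefinable (R i)) : FODefinable fun V G v => ∀ i, R i V G v := by
  choose ψ hψ using hR
  refine ⟨Language.Formula.iInf ψ, fun V G v => ?_⟩
  let _ := graphStructure G
  exact (forall_congr' fun i => hψ i V G v).trans Language.Formula.realize_iInf.symm

theorem iOr [Finite ι] {R : ι → ∀ V : Type, Digraph V → (α → V) → Prop}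
    (hR : ∀ i, FODefinable (R i)) : FODefinable fun V G v => ∃ i, R i V G v := by
  choose ψ hψ using hR
  refine ⟨Language.Formula.iSup ψ, fun V G v => ?_⟩
  let _ := graphStructure G
  exact (exists_congr fun i => hψ i V G v).trans Language.Formula.realize_iSup.symm

theorem exs [Finite β] {R : ∀ V : Type, Digraph V → (α → V) → (β → V) → Prop}
    (hR : FODefinable (α := α ⊕ β) fun V G v => R V G (fun a => v (.inl a)) fun b => v (.inr b)) :
    FODefinable fun V G v => ∃ w : β → V, R V G v w := by
  obtain ⟨ψ, hψ⟩ := hR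
  refine ⟨ψ.iExs β, fun V G v => ?_⟩
  let _ := graphStructure G
  refine Iff.trans ?_ Language.Formula.realize_iExs.symm
  exact exists_congr fun w => hψ V G (Sum.elim v w)

theorem ex {R : ∀ V : Type, Digraph V → (α → V) → V → Prop}
    (hR : FODefinable (α := α ⊕ Unit) fun V G v => R V G (fun a => v (.inl a)) (v (.inr ()))) :
    FODefinable fun V G v => ∃ x, R V G v x :=
  (exs (R := fun V G v w => R V G v (w ())) hR).congr fun _ _ _ =>
    ⟨fun ⟨x, hx⟩ => ⟨fun _ => x, hx⟩, fun ⟨w, hw⟩ => ⟨w (), hw⟩⟩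

theorem all {R : ∀ V : Type, Digraph V → (α → V) → V → Prop}
    (hR : FODefinable (α := α ⊕ Unit) fun V G v => R V G (fun a => v (.inl a)) (v (.inr ()))) :
    FODefinable fun V G v => ∀ x, R V G v x :=
  (ex (R := fun V G v x => ¬ R V G v x) hR.not).not.congr fun V G v => by simp

end FODefinable

/-! ### Invariance under isomorphism -/

theorem InfFormula.sat_iso {V W : Type} {G : Digraph V} {H : Digraph W} (e : G.Adj ≃r H.Adj)
    {k : ℕ} (φ : InfFormula.{u} k) (v : Fin k → V) : φ.Sat G v ↔ φ.Sat H (e ∘ v) := by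
  have upd : ∀ (v : Fin k → V) i a,
      e ∘ Function.update v i a = Function.update (e ∘ v) i (e a) := fun v i a =>
    Function.comp_update _ _ _ _
  induction φ generalizing v with
  | equal i j => simp [Sat]
  | adj i j => exact e.map_rel_iff.symm
  | neg φ ih => exact not_congr (ih v)
  | ex i φ ih =>
    simp only [Sat, ih, upd]
    exact (e.surjective.exists (p := fun a => φ.Sat H (Function.update (e ∘ v) i a))).symm
  | all i φ ih =>
    simp only [Sat, ih, upd]
    exact (e.surjective.forall (p := fun a => φ.Sat H (Function.update (e ∘ v) i a))).symm
  | disj φ ih => exact exists_congr fun i => ih i v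
  | conj φ ih => exact forall_congr' fun i => ih i v

theorem FODefinable.iso {α : Type} {R : ∀ V : Type, Digraph V → (α → V) → Prop}
    (hR : FODefinable R) {V W : Type} {G : Digraph V} {H : Digraph W} (e : G.Adj ≃r H.Adj)
    (v : α → V) : R V G v ↔ R W H (e ∘ v) := by
  obtain ⟨ψ, hψ⟩ := hR
  rw [hψ, hψ]
  let _ := graphStructure G
  let _ := graphStructure H
  let g : V ≃[Language.graph] W :=
    { e.toEquiv with
      map_fun' := fun f => f.elim
      map_rel' := fun {n} r x => by
        cases r
        exact e.map_rel_iff }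
  exact (Language.StrongHomClass.realize_formula g ψ).symm

/-- A finite directed graph and a set of assignments in it are first-order definable up to
isomorphism. -/
theorem FODefinable.image_of_finite {V : Type} [Finite V] (G : Digraph V) {α : Type} [Finite α]
    (U : Set (α → V)) :
    FODefinable fun W (H : Digraph W) (w : α → W) =>
      ∃ e : G.Adj ≃r H.Adj, ∃ u ∈ U, w = e ∘ u := by
  refine FODefinable.congr (R := fun W (H : Digraph W) (w : α → W) =>
    -- An isomorphism is an enumeration of `W` indexed by the finite set `V`: one existential
    -- quantifier per vertex of `G`.
    ∃ y : V → W, (∀ a b, (H.Adj (y a) (y b) ↔ G.Adj a b) ∧ (y a = y b ↔ a = b)) ∧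
      (∀ x, ∃ a, x = y a) ∧ ∃ u : U, ∀ i, w i = y (u.1 i)) ?_ fun W H w => ?_
  · refine exs (.and (.iAnd fun a => .iAnd fun b => .and (.iff (.adj _ _) (.const _))
      (.iff (.eq _ _) (.const _))) (.and (.all (.iOr fun a => ?_)) ?_))
    · exact .eq (α := (α ⊕ V) ⊕ Unit) (.inr ()) (.inl (.inr a))
    · exact .iOr fun u => .iAnd fun i => .eq _ _
  · constructor
    · rintro ⟨e, u, hu, rfl⟩
      exact ⟨e, fun a b => ⟨e.map_rel_iff, e.injective.eq_iff⟩,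
        fun x => ⟨e.symm x, (e.apply_symm_apply x).symm⟩, ⟨u, hu⟩, fun i => rfl⟩
    · rintro ⟨y, hy, hs, ⟨u, hu⟩, hw⟩
      refine ⟨⟨Equiv.ofBijective y ⟨fun a b h => (hy a b).2.1 h, fun x => ?_⟩,
        fun {a b} => (hy a b).1⟩, u, hu, funext hw⟩
      obtain ⟨a, ha⟩ := hs x
      exact ⟨a, ha.symm⟩

/-- The closure of a class of finite directed graphs under isomorphism. -/
def isoClosure (K : Set FinDigraph) : Set FinDigraph :=
  {H | ∃ G ∈ K, Nonempty (G.graph.Adj ≃r H.graph.Adj)}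

theorem isoClosed_isoClosure (K : Set FinDigraph) : IsoClosed (isoClosure K) := by
  rintro G H ⟨F, hF, ⟨e⟩⟩ ⟨f⟩
  exact ⟨F, hF, ⟨e.trans f⟩⟩

/-- If an infinitary formula agrees with a definable relation on all but finitely many members of a
sequence of finite directed graphs, it is equivalent to a first-order formula on the sequence. -/
theorem equivFirstOrder_of_forall_gt (G : ℕ → FinDigraph) (φ : InfinitaryFormula.{u}) (i : ℕ)
    {R : ∀ V : Type, Digraph V → (Fin φ.1 → V) → Prop} (hR : FODefinable R)
    (h : ∀ n, i < n → ∀ v, φ.2.Sat (G n).graph v ↔ R _ (G n).graph v) :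
    EquivFirstOrder (isoClosure (Set.range G)) φ := by
  -- With `Set.univ` the image relation just says that the graph is isomorphic to `G n`. The final
  -- formula uses the exact truth table of `φ` on the first `i + 1` graphs and `R` elsewhere.
  have hI := fun n : Fin (i + 1) =>
    FODefinable.image_of_finite (G n).graph (α := Fin φ.1) Set.univ
  have hU := fun n : Fin (i + 1) =>
    FODefinable.image_of_finite (G n).graph {v | φ.2.Sat (G n).graph v}
  obtain ⟨ψ, hψ⟩ := (FODefinable.iOr hU).or ((FODefinable.iOr hI).not.and hR)
  refine ⟨ψ, ?_⟩
  rintro H ⟨_, ⟨n, rfl⟩, ⟨e⟩⟩ w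
  rw [← hψ]
  obtain ⟨v, rfl⟩ : ∃ v : Fin φ.1 → (G n).V, w = e ∘ v :=
    ⟨e.symm ∘ w, by ext; simp⟩
  constructor
  · intro hw
    by_cases hn : ∃ m : Fin (i + 1), Nonempty ((G m).graph.Adj ≃r H.graph.Adj)
    · obtain ⟨m, ⟨f⟩⟩ := hn
      refine .inl ⟨m, f, f.symm ∘ e ∘ v, ?_, by ext; simp⟩
      rw [Set.mem_ofPred_eq, InfFormula.sat_iso f]
      convert hw using 1
      ext; simp
    · refine .inr ⟨fun ⟨m, f, _⟩ => hn ⟨m, ⟨f⟩⟩, ?_⟩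
      have hin : i < n := by
        by_contra hin
        exact hn ⟨⟨n, by omega⟩, ⟨e⟩⟩
      rw [← hR.iso e, ← h n hin, InfFormula.sat_iso e]
      exact hw
  · rintro (⟨m, f, u, hu, hv⟩ | ⟨hn, hr⟩)
    · rw [hv, ← InfFormula.sat_iso f]
      exact hu
    · have hin : i < n := by
        by_contra hin
        exact hn ⟨⟨n, by omega⟩, e, v, trivial, rfl⟩
      rw [← InfFormula.sat_iso e, h n hin, hR.iso e]
      exact hr

/-! ### Multigraphs and their subdivisions -/

/-- A finite directed multigraph: `mult x y` is the number of parallel edges from `x` to `y`. -/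
structure Multigraph where
  X : Type
  [fin : Finite X]
  mult : X → X → ℕ

namespace Multigraph

attribute [instance] Multigraph.fin

/-- The edges of a multigraph. -/
abbrev Edge (M : Multigraph) : Type := Σ p : M.X × M.X, Fin (M.mult p.1 p.2)

/-- The points of the subdivision: the vertices and the edges of the multigraph. -/
abbrev Point (M : Multigraph) : Type := M.X ⊕ M.Edge

/-- The subdivision of a multigraph: every edge `e` from `x` to `y` is replaced by a path
`x → e → y`. -/
def subdivision (M : Multigraph) : Digraph M.Point where
  Adj
    | .inl x, .inr e => e.1.1 = x
    | .inr e, .inl y => e.1.2 = y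
    | _, _ => False

/-- The source (`false`) and the target (`true`) of an edge; both are `x` for a vertex `x`. -/
def endpoint (M : Multigraph) : M.Point → Bool → M.X
  | .inl x, _ => x
  | .inr e, false => e.1.1
  | .inr e, true => e.1.2

variable {A M M' : Multigraph}

/-- Adjacency is determined by which points are vertices and by coincidences of endpoints, so
similarity of tuples needs no clause of its own for edges. -/
theorem adj_iff (z w : M.Point) : M.subdivision.Adj z w ↔
    (z.isLeft = true ∧ ¬ w.isLeft = true ∧ M.endpoint w false = M.endpoint z false) ∨
    (¬ z.isLeft = true ∧ w.isLeft = true ∧ M.endpoint z true = M.endpoint w false) := by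
  rcases z with x | e <;> rcases w with y | e' <;> simp [subdivision, endpoint]

theorem eq_inr_of_endpoint {z : M.Point} (hz : ¬ z.isLeft = true) :
    ∃ c, z = .inr ⟨(M.endpoint z false, M.endpoint z true), c⟩ := by
  rcases z with x | ⟨⟨x, y⟩, c⟩
  · simp at hz
  · exact ⟨c, rfl⟩

/-- `M'` extends `M` along `f`, and all multiplicities that involve a new vertex are at least
`N`. -/
structure Extends (N : ℕ) (M M' : Multigraph) (f : M.X → M'.X) : Prop where
  injective : Function.Injective f
  mult_eq : ∀ x y, M'.mult (f x) (f y) = M.mult x y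
  le_mult : ∀ x y, (x ∉ Set.range f ∨ y ∉ Set.range f) → N ≤ M'.mult x y

theorem Extends.refl (N : ℕ) (M : Multigraph) : Extends N M M id :=
  ⟨Function.injective_id, fun _ _ => rfl, by simp⟩

theorem Extends.mono {N N' : ℕ} {f : M.X → M'.X} (h : Extends N M M' f) (hN : N' ≤ N) :
    Extends N' M M' f :=
  ⟨h.injective, h.mult_eq, fun x y hxy => hN.trans (h.le_mult x y hxy)⟩

theorem Extends.trans {N N' : ℕ} {f : A.X → M.X} {g : M.X → M'.X} (hf : Extends N A M f)
    (hg : Extends N' M M' g) (hN : N ≤ N') : Extends N A M' (g ∘ f) := by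
  refine ⟨hg.injective.comp hf.injective, fun x y => by simp [hg.mult_eq, hf.mult_eq], ?_⟩
  intro x y hxy
  by_cases h : x ∉ Set.range g ∨ y ∉ Set.range g
  · exact hN.trans (hg.le_mult x y h)
  · push Not at h
    obtain ⟨⟨x, rfl⟩, ⟨y, rfl⟩⟩ := h
    rw [hg.mult_eq]
    refine hf.le_mult x y (hxy.imp ?_ ?_) <;> exact fun h ⟨a, ha⟩ => h ⟨a, by simp [ha]⟩

/-- There are at least `2 * k` vertices outside the range of `f`. -/
def Room (k : ℕ) (A M : Multigraph) (f : A.X → M.X) : Prop :=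
  ∃ g : Fin (2 * k) → M.X, Function.Injective g ∧ ∀ i a, g i ≠ f a

/-! ### The back-and-forth system -/

/-- Two tuples of points have the same equalities among their entries and endpoints, the same
entries that are vertices, and the same endpoints in `A`. -/
structure Similar {ι : Type} (f : A.X → M.X) (f' : A.X → M'.X) (v : ι → M.Point)
    (v' : ι → M'.Point) : Prop where
  eq_iff : ∀ p q, v p = v q ↔ v' p = v' q
  isLeft_iff : ∀ p, (v p).isLeft = true ↔ (v' p).isLeft = true
  endpoint_iff : ∀ p s q t, M.endpoint (v p) s = M.endpoint (v q) t ↔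
    M'.endpoint (v' p) s = M'.endpoint (v' q) t
  base_iff : ∀ p s a, M.endpoint (v p) s = f a ↔ M'.endpoint (v' p) s = f' a

theorem Similar.symm {ι : Type} {f : A.X → M.X} {f' : A.X → M'.X} {v : ι → M.Point}
    {v' : ι → M'.Point} (h : Similar f f' v v') : Similar f' f v' v :=
  ⟨fun p q => (h.eq_iff p q).symm, fun p => (h.isLeft_iff p).symm,
    fun p s q t => (h.endpoint_iff p s q t).symm, fun p s a => (h.base_iff p s a).symm⟩

/-- A base vertex or an entry already present has a forced answer. Any other vertex is answered by a
fresh one: fewer than `2 * k` entries cannot exhaust the room. -/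
theorem exists_vertex_similar {k : ℕ} {f : A.X → M.X} {f' : A.X → M'.X}
    (hf : Function.Injective f) (hf' : Function.Injective f') (room : Room k A M' f') {ι : Type}
    [Finite ι] (hι : Nat.card ι < 2 * k) {z : ι → M.X} {z' : ι → M'.X}
    (hz : ∀ p q, z p = z q ↔ z' p = z' q) (hb : ∀ p a, z p = f a ↔ z' p = f' a) (x : M.X) :
    ∃ x' : M'.X, (∀ p, z p = x ↔ z' p = x') ∧ ∀ a, x = f a ↔ x' = f' a := by
  by_cases h1 : ∃ a, x = f a
  · obtain ⟨a, rfl⟩ := h1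
    exact ⟨f' a, fun p => hb p a, fun b => by rw [hf.eq_iff, hf'.eq_iff]⟩
  by_cases h2 : ∃ p, z p = x
  · obtain ⟨p, rfl⟩ := h2
    exact ⟨z' p, fun q => hz q p, hb p⟩
  push Not at h1 h2
  obtain ⟨g, hg, hga⟩ := room
  obtain ⟨i, hi⟩ : ∃ i, ∀ p, z' p ≠ g i := by
    by_contra! h
    choose p hp using h
    have hp : Function.Injective p := fun i j hij => hg (by rw [← hp i, ← hp j, hij])
    have := Nat.card_le_card_of_injective p hp
    simp at this
    omega
  exact ⟨g i, fun p => iff_of_false (h2 p) (hi p), fun a => iff_of_false (h1 a) (hga i a)⟩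

/-- The answer must be an unused parallel edge. Between base vertices both multiplicities agree, so
if every copy on one side is used, every copy on the other is too. Elsewhere there are at least `k`
copies and fewer than `k` entries. -/
theorem exists_edge_similar {k : ℕ} {f : A.X → M.X} {f' : A.X → M'.X} (hf : Extends k A M f)
    (hf' : Extends k A M' f') {ι : Type} [Finite ι] (hι : Nat.card ι < k) {v : ι → M.Point}
    {v' : ι → M'.Point} (h : Similar f f' v v') {x y : M.X} (c : Fin (M.mult x y)) {x' y' : M'.X}
    (hx : ∀ p s, M.endpoint (v p) s = x ↔ M'.endpoint (v' p) s = x')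
    (hy : ∀ p s, M.endpoint (v p) s = y ↔ M'.endpoint (v' p) s = y')
    (hxb : ∀ a, x = f a ↔ x' = f' a) (hyb : ∀ a, y = f a ↔ y' = f' a) :
    ∃ c' : Fin (M'.mult x' y'), ∀ p, v p = .inr ⟨(x, y), c⟩ ↔ v' p = .inr ⟨(x', y'), c'⟩ := by
  by_cases h1 : ∃ p, v p = .inr ⟨(x, y), c⟩
  · obtain ⟨p, hp⟩ := h1
    have hl : ¬ (v' p).isLeft = true := by simp [← h.isLeft_iff, hp]
    obtain ⟨c', hc'⟩ := eq_inr_of_endpoint hl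
    obtain rfl : M'.endpoint (v' p) false = x' := by rw [← hx, hp]; rfl
    obtain rfl : M'.endpoint (v' p) true = y' := by rw [← hy, hp]; rfl
    refine ⟨c', fun q => ?_⟩
    rw [← hp, ← hc', h.eq_iff]
  push Not at h1
  suffices ∃ c' : Fin (M'.mult x' y'), ∀ p, v' p ≠ .inr ⟨(x', y'), c'⟩ by
    obtain ⟨c', hc'⟩ := this
    exact ⟨c', fun p => iff_of_false (h1 p) (hc' p)⟩
  by_contra! h2
  choose p hp using h2
  have inj : Function.Injective p := fun i j hij => by
    have := hp i
    rw [hij, hp j] at this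
    simpa using this.symm
  by_cases hbase : (∃ a, x = f a) ∧ ∃ b, y = f b
  · obtain ⟨⟨a, ha⟩, ⟨b, hb⟩⟩ := hbase
    have hm : M'.mult x' y' = M.mult x y := by
      rw [(hxb a).1 ha, (hyb b).1 hb, hf'.mult_eq, ha, hb, hf.mult_eq]
    have hd : ∀ i, ∃ d, v (p i) = .inr ⟨(x, y), d⟩ := by
      intro i
      have hl : ¬ (v (p i)).isLeft = true := by simp [h.isLeft_iff, hp]
      obtain ⟨d, hd⟩ := eq_inr_of_endpoint hl
      obtain rfl : M.endpoint (v (p i)) false = x := by rw [hx, hp]; rfl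
      obtain rfl : M.endpoint (v (p i)) true = y := by rw [hy, hp]; rfl
      exact ⟨d, hd⟩
    choose d hd using hd
    have dinj : Function.Injective d := fun i j hij => by
      have : v (p i) = v (p j) := by rw [hd, hd, hij]
      rw [h.eq_iff, hp, hp] at this
      simpa using this
    obtain ⟨i, hi⟩ := (dinj.bijective_of_nat_card_le (by simp [hm])).surjective c
    exact h1 (p i) (by rw [hd, hi])
  · have hout : x' ∉ Set.range f' ∨ y' ∉ Set.range f' := by
      by_contra! hcon
      obtain ⟨⟨a, ha⟩, ⟨b, hb⟩⟩ := hcon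
      exact hbase ⟨⟨a, (hxb a).2 ha.symm⟩, ⟨b, (hyb b).2 hb.symm⟩⟩
    have h3 := hf'.le_mult x' y' hout
    have := Nat.card_le_card_of_injective p inj
    simp at this
    omega

/-- A point that extends one of two similar tuples is matched by a point that extends the other. -/
theorem exists_point_similar {k : ℕ} {f : A.X → M.X} {f' : A.X → M'.X} (hf : Extends k A M f)
    (hf' : Extends k A M' f') (room : Room k A M' f') {ι : Type} [Finite ι] (hι : Nat.card ι < k)
    {v : ι → M.Point} {v' : ι → M'.Point} (h : Similar f f' v v') (w : M.Point) :
    ∃ w' : M'.Point, (∀ p, v p = w ↔ v' p = w') ∧ (w.isLeft = true ↔ w'.isLeft = true) ∧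
      (∀ p s t, M.endpoint (v p) s = M.endpoint w t ↔ M'.endpoint (v' p) s = M'.endpoint w' t) ∧
      (∀ s t, M.endpoint w s = M.endpoint w t ↔ M'.endpoint w' s = M'.endpoint w' t) ∧
      ∀ s a, M.endpoint w s = f a ↔ M'.endpoint w' s = f' a := by
  have hc : Nat.card (ι × Bool) = Nat.card ι * 2 := by simp
  have hx := exists_vertex_similar hf.injective hf'.injective room (ι := ι × Bool) (by omega)
    (z := fun p => M.endpoint (v p.1) p.2) (z' := fun p => M'.endpoint (v' p.1) p.2)
    (fun p q => h.endpoint_iff _ _ _ _) (fun p a => h.base_iff _ _ a)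
  rcases w with x | ⟨⟨x, y⟩, c⟩
  · obtain ⟨x', hx', hxb⟩ := hx x
    refine ⟨.inl x', fun p => ?_, by simp, fun p s t => hx' (p, s), by simp [endpoint],
      fun s a => hxb a⟩
    have e : ∀ {N : Multigraph} (z : N.Point) (x : N.X), z = .inl x ↔
        z.isLeft = true ∧ N.endpoint z false = x := by
      rintro N (z | z) x <;> simp [endpoint]
    rw [e, e, h.isLeft_iff]
    exact and_congr_right fun _ => hx' (p, false)
  · obtain ⟨x', hx', hxb⟩ := hx x
    -- The target must also compare correctly with the chosen source, which joins the endpoints as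
    -- one more entry. At most `2 * (k - 1) + 1` entries result, whence the room of `2 * k`.
    obtain ⟨y', hy', hyb⟩ := exists_vertex_similar hf.injective hf'.injective room
      (ι := Option (ι × Bool)) (by rw [Finite.card_option]; omega)
      (z := fun p => p.elim x fun p => M.endpoint (v p.1) p.2)
      (z' := fun p => p.elim x' fun p => M'.endpoint (v' p.1) p.2)
      (by
        rintro (_ | p) (_ | q)
        · simp
        · exact eq_comm.trans ((hx' q).trans eq_comm)
        · exact hx' p
        · exact h.endpoint_iff _ _ _ _)
      (by
        rintro (_ | p) a
        · exact hxb a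
        · exact h.base_iff _ _ a) y
    obtain ⟨c', hc'⟩ := exists_edge_similar hf hf' hι h c (fun p s => hx' (p, s))
      (fun p s => hy' (some (p, s))) hxb hyb
    refine ⟨.inr ⟨(x', y'), c'⟩, hc', by simp, ?_, ?_, ?_⟩
    · rintro p s (_ | _)
      · exact hx' (p, s)
      · exact hy' (some (p, s))
    · rintro (_ | _) (_ | _)
      · simp
      · exact hy' none
      · exact eq_comm.trans ((hy' none).trans eq_comm)
      · simp
    · rintro (_ | _) a
      · exact hxb a
      · exact hyb a

/-- The overwritten entry is forgotten, so the new point is matched against only `k - 1` others. -/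
theorem Similar.exists_update {k : ℕ} {f : A.X → M.X} {f' : A.X → M'.X} (hf : Extends k A M f)
    (hf' : Extends k A M' f') (room : Room k A M' f') {v : Fin k → M.Point}
    {v' : Fin k → M'.Point} (h : Similar f f' v v') (i : Fin k) (w : M.Point) :
    ∃ w', Similar f f' (Function.update v i w) (Function.update v' i w') := by
  have hcard : Nat.card {j // j ≠ i} < k := by
    have := i.pos
    simp
    omega
  obtain ⟨w', h1, h2, h3, h4, h5⟩ := exists_point_similar hf hf' room hcard
    (v := fun j : {j // j ≠ i} => v j) (v' := fun j => v' j)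
    ⟨fun p q => h.eq_iff _ _, fun p => h.isLeft_iff _, fun p s q t => h.endpoint_iff _ _ _ _,
      fun p s a => h.base_iff _ _ _⟩ w
  refine ⟨w', ?_, ?_, ?_, ?_⟩
  · intro p q
    by_cases hp : p = i <;> by_cases hq : q = i
    · simp [hp, hq]
    · subst hp
      simpa [hq] using eq_comm.trans ((h1 ⟨q, hq⟩).trans eq_comm)
    · subst hq
      simpa [hp] using h1 ⟨p, hp⟩
    · simpa [hp, hq] using h.eq_iff p q
  · intro p
    by_cases hp : p = i
    · subst hp; simpa using h2
    · simpa [hp] using h.isLeft_iff p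
  · intro p s q t
    by_cases hp : p = i <;> by_cases hq : q = i
    · subst hp; subst hq; simpa using h4 s t
    · subst hp
      simpa [hq] using eq_comm.trans ((h3 ⟨q, hq⟩ t s).trans eq_comm)
    · subst hq
      simpa [hp] using h3 ⟨p, hp⟩ s t
    · simpa [hp, hq] using h.endpoint_iff p s q t
  · intro p s a
    by_cases hp : p = i
    · subst hp; simpa using h5 s a
    · simpa [hp] using h.base_iff p s a

theorem Similar.adj_iff {ι : Type} {f : A.X → M.X} {f' : A.X → M'.X} {v : ι → M.Point}
    {v' : ι → M'.Point} (h : Similar f f' v v') (p q : ι) :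
    M.subdivision.Adj (v p) (v q) ↔ M'.subdivision.Adj (v' p) (v' q) := by
  simp only [Multigraph.adj_iff, h.isLeft_iff, h.endpoint_iff]

/-- Similar `k`-tuples satisfy the same infinitary formulas with `k` variables. -/
theorem Similar.sat_iff {k : ℕ} {f : A.X → M.X} {f' : A.X → M'.X} (hf : Extends k A M f)
    (hf' : Extends k A M' f') (room : Room k A M f) (room' : Room k A M' f')
    (φ : InfFormula.{u} k) {v : Fin k → M.Point} {v' : Fin k → M'.Point}
    (h : Similar f f' v v') : φ.Sat M.subdivision v ↔ φ.Sat M'.subdivision v' := by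
  induction φ generalizing v v' with
  | equal i j => exact h.eq_iff i j
  | adj i j => exact h.adj_iff i j
  | neg φ ih => exact not_congr (ih h)
  | ex i φ ih =>
    constructor
    · rintro ⟨w, hw⟩
      obtain ⟨w', h'⟩ := h.exists_update hf hf' room' i w
      exact ⟨w', (ih h').1 hw⟩
    · rintro ⟨w', hw⟩
      obtain ⟨w, h'⟩ := h.symm.exists_update hf' hf room i w'
      exact ⟨w, (ih h'.symm).2 hw⟩
  | all i φ ih =>
    constructor
    · intro hv w'
      obtain ⟨w, h'⟩ := h.symm.exists_update hf' hf room i w'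
      exact (ih h'.symm).1 (hv w)
    · intro hv w
      obtain ⟨w', h'⟩ := h.exists_update hf hf' room' i w
      exact (ih h').2 (hv w')
  | disj φ ih => exact exists_congr fun j => ih j h
  | conj φ ih => exact forall_congr' fun j => ih j h

end Multigraph

/-! ### Reading a multigraph off its subdivision -/

/-- A point with at least two successors. -/
def IsVertex {V : Type} (G : Digraph V) (x : V) : Prop :=
  ∃ y z, y ≠ z ∧ G.Adj x y ∧ G.Adj x z

/-- There are at least `q` paths of length two from `x` to `y`. -/
def HasPaths {V : Type} (G : Digraph V) (q : ℕ) (x y : V) : Prop :=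
  ∃ z : Fin q → V, (∀ i j, z i = z j ↔ i = j) ∧ ∀ i, G.Adj x (z i) ∧ G.Adj (z i) y

/-- There are exactly `q` paths of length two from `x` to `y`. -/
def HasExactPaths {V : Type} (G : Digraph V) (q : ℕ) (x y : V) : Prop :=
  HasPaths G q x y ∧ ¬ HasPaths G (q + 1) x y

/-- The relation "`x` is the source (`false`) or the target (`true`) of `z`". -/
def IsEndpoint {V : Type} (G : Digraph V) (z : V) (s : Bool) (x : V) : Prop :=
  IsVertex G x ∧ (z = x ∨ ¬ IsVertex G z ∧ ((s = true ∧ G.Adj z x) ∨ (s = false ∧ G.Adj x z)))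

namespace FODefinable

variable {α : Type}

theorem isVertex (a : α) : FODefinable fun _ G v => IsVertex G (v a) :=
  .ex (.ex (.and (.not (.eq (α := (α ⊕ Unit) ⊕ Unit) (.inl (.inr ())) (.inr ())))
    (.and (.adj (α := (α ⊕ Unit) ⊕ Unit) (.inl (.inl a)) (.inl (.inr ())))
      (.adj (α := (α ⊕ Unit) ⊕ Unit) (.inl (.inl a)) (.inr ())))))

theorem hasPaths (q : ℕ) (a b : α) : FODefinable fun _ G v => HasPaths G q (v a) (v b) :=
  .exs (.and (.iAnd fun i => .iAnd fun j => .iff (.eq (α := α ⊕ Fin q) (.inr i) (.inr j)) (.const _))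
    (.iAnd fun i => .and (.adj (α := α ⊕ Fin q) (.inl a) (.inr i))
      (.adj (α := α ⊕ Fin q) (.inr i) (.inl b))))

theorem hasExactPaths (q : ℕ) (a b : α) :
    FODefinable fun _ G v => HasExactPaths G q (v a) (v b) :=
  (hasPaths q a b).and (hasPaths (q + 1) a b).not

theorem isEndpoint (a : α) (s : Bool) (b : α) :
    FODefinable fun _ G v => IsEndpoint G (v a) s (v b) :=
  (isVertex b).and ((eq a b).or ((isVertex a).not.and
    (((const _).and (adj a b)).or ((const _).and (adj b a)))))

end FODefinable

namespace Multigraph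

variable {M : Multigraph}

/-- An edge point has exactly one successor, while a vertex has at least two because it carries at
least two loops. -/
theorem isVertex_subdivision (hM : ∀ x y, 2 ≤ M.mult x y) (z : M.Point) :
    IsVertex M.subdivision z ↔ z.isLeft = true := by
  rcases z with x | e
  · simp only [Sum.isLeft_inl, iff_true]
    refine ⟨.inr ⟨(x, x), ⟨0, zero_lt_two.trans_le (hM x x)⟩⟩,
      .inr ⟨(x, x), ⟨1, one_lt_two.trans_le (hM x x)⟩⟩, by simp, rfl, rfl⟩
  · simp only [Sum.isLeft_inr, Bool.false_eq_true, iff_false]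
    rintro ⟨y | y, z | z, hyz, hy, hz⟩ <;> simp [subdivision] at hy hz
    exact hyz (by rw [← hy, ← hz])

theorem isEndpoint_subdivision (hM : ∀ x y, 2 ≤ M.mult x y) (z : M.Point) (s : Bool)
    (w : M.Point) : IsEndpoint M.subdivision z s w ↔ w = .inl (M.endpoint z s) := by
  simp only [IsEndpoint, isVertex_subdivision hM, adj_iff]
  rcases z with x | e <;> rcases w with y | e' <;> cases s <;> simp [endpoint, eq_comm]

theorem hasPaths_subdivision (q : ℕ) (x y : M.X) :
    HasPaths M.subdivision q (.inl x) (.inl y) ↔ q ≤ M.mult x y := by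
  constructor
  · rintro ⟨z, hz, h⟩
    have : ∀ i, ∃ c : Fin (M.mult x y), z i = .inr ⟨(x, y), c⟩ := by
      intro i
      obtain ⟨h1, h2⟩ := h i
      rcases hzi : z i with w | ⟨⟨a, b⟩, c⟩
      · simp [hzi, subdivision] at h1
      · rw [hzi] at h1 h2
        obtain rfl : a = x := h1
        obtain rfl : b = y := h2
        exact ⟨c, rfl⟩
    choose c hc using this
    have inj : Function.Injective c := fun i j hij => (hz i j).1 (by rw [hc, hc, hij])
    simpa using Nat.card_le_card_of_injective c inj
  · intro h
    exact ⟨fun i => .inr ⟨(x, y), i.castLE h⟩, fun i j => by simp, fun i => ⟨rfl, rfl⟩⟩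

theorem hasExactPaths_subdivision (q : ℕ) (x y : M.X) :
    HasExactPaths M.subdivision q (.inl x) (.inl y) ↔ M.mult x y = q := by
  rw [HasExactPaths, hasPaths_subdivision, hasPaths_subdivision]
  omega

/-- Two different midpoints rule out an edge point as start, since it has one successor. No path of
length two from a vertex ends in an edge point. -/
theorem eq_inl_of_hasPaths {q : ℕ} (hq : 2 ≤ q) {z w : M.Point}
    (h : HasPaths M.subdivision q z w) : ∃ x y, z = .inl x ∧ w = .inl y := by
  obtain ⟨p, hp, h⟩ := h
  have h0 := h ⟨0, by omega⟩
  have h1 := h ⟨1, by omega⟩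
  have hne : p ⟨0, by omega⟩ ≠ p ⟨1, by omega⟩ := fun h => by simpa using (hp _ _).1 h
  rcases z with x | e
  · rcases w with y | e
    · exact ⟨x, y, rfl, rfl⟩
    · rcases hp0 : p ⟨0, by omega⟩ with a | a <;> rw [hp0] at h0
      · exact h0.1.elim
      · exact h0.2.elim
  · have key : ∀ t, M.subdivision.Adj (.inr e) t → t = .inl e.1.2 := by
      rintro (t | t) ht
      · exact congrArg Sum.inl (show e.1.2 = t from ht).symm
      · exact ht.elim
    exact (hne (by rw [key _ h0.1, key _ h1.1])).elim

end Multigraph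

/-! ### Recording the truth of an infinitary formula -/

/-- A finite description of a `k`-tuple of points of a subdivision: the equalities of its entries,
the entries that are vertices, and the equalities of endpoints. -/
abbrev Pattern (k : ℕ) : Type :=
  (Fin k → Fin k → Prop) × (Fin k → Prop) × (Fin k × Bool → Fin k × Bool → Prop)

/-- The labels that are recorded in multiplicities. -/
abbrev Label (k : ℕ) : Type := Option (Pattern k ⊕ Set (Fin k × Bool))

/-- A numbering of the labels. -/
noncomputable def Label.code {k : ℕ} (l : Label k) : ℕ := Finite.equivFin (Label k) l

theorem Label.code_lt {k : ℕ} (l : Label k) : l.code < Nat.card (Label k) :=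
  (Finite.equivFin (Label k) l).isLt

theorem Label.code_inj {k : ℕ} {l l' : Label k} : l.code = l'.code ↔ l = l' := by
  rw [Label.code, Label.code, Fin.val_inj, (Finite.equivFin (Label k)).apply_eq_iff_eq]

/-- The tuple `v` has the pattern `π`. -/
def HasPattern {V : Type} (G : Digraph V) {k : ℕ} (π : Pattern k) (v : Fin k → V) : Prop :=
  (∀ p q, v p = v q ↔ π.1 p q) ∧ (∀ p, IsVertex G (v p) ↔ π.2.1 p) ∧
    ∀ σ τ, (∃ x, IsEndpoint G (v σ.1) σ.2 x ∧ IsEndpoint G (v τ.1) τ.2 x) ↔ π.2.2 σ τ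

/-- Some vertex `x` records the pattern of `v` and the endpoints of `v` that lie below level `N`. -/
def IsRecorded {V : Type} (G : Digraph V) {k : ℕ} (N : ℕ) (v : Fin k → V) : Prop :=
  ∃ x, (∃ π : Pattern k, HasPattern G π v ∧
      HasExactPaths G (N + Label.code (some (.inl π))) x x) ∧
    ∀ a, IsVertex G a ∧ ¬ HasPaths G N a a → ∃ S : Set (Fin k × Bool),
      (∀ σ, IsEndpoint G (v σ.1) σ.2 a ↔ σ ∈ S) ∧
        HasExactPaths G (N + Label.code (some (.inr S))) x a

theorem FODefinable.hasPattern {k : ℕ} (π : Pattern k) {α : Type} (f : Fin k → α) :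
    FODefinable (α := α) fun _ G v => HasPattern G π fun p => v (f p) :=
  .and (.iAnd fun p => .iAnd fun q => .iff (.eq (f p) (f q)) (.const _))
    (.and (.iAnd fun p => .iff (.isVertex (f p)) (.const _))
      (.iAnd fun σ => .iAnd fun τ => .iff
        (.ex (.and (.isEndpoint (α := α ⊕ Unit) (.inl (f σ.1)) σ.2 (.inr ()))
          (.isEndpoint (α := α ⊕ Unit) (.inl (f τ.1)) τ.2 (.inr ())))) (.const _)))

theorem FODefinable.isRecorded (k N : ℕ) :
    FODefinable fun _ G (v : Fin k → _) => IsRecorded G N v :=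
  .ex (.and
    (.iOr fun π => .and (.hasPattern (α := Fin k ⊕ Unit) π .inl)
      (.hasExactPaths (α := Fin k ⊕ Unit) _ (.inr ()) (.inr ())))
    (.all (.imp
      (.and (.isVertex (α := (Fin k ⊕ Unit) ⊕ Unit) (.inr ()))
        (.not (.hasPaths (α := (Fin k ⊕ Unit) ⊕ Unit) N (.inr ()) (.inr ()))))
      (.iOr fun _ => .and
        (.iAnd fun σ => .iff (.isEndpoint (α := (Fin k ⊕ Unit) ⊕ Unit) (.inl (.inl σ.1)) σ.2
          (.inr ())) (.const _))
        (.hasExactPaths (α := (Fin k ⊕ Unit) ⊕ Unit) _ (.inl (.inr ())) (.inr ()))))))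

namespace Multigraph

variable {A M : Multigraph} {k : ℕ}

/-- The pattern of a tuple of points. -/
def pattern (M : Multigraph) (v : Fin k → M.Point) : Pattern k :=
  (fun p q => v p = v q, fun p => (v p).isLeft = true,
    fun σ τ => M.endpoint (v σ.1) σ.2 = M.endpoint (v τ.1) τ.2)

theorem hasPattern_subdivision (hM : ∀ x y, 2 ≤ M.mult x y) (π : Pattern k)
    (v : Fin k → M.Point) : HasPattern M.subdivision π v ↔ M.pattern v = π := by
  simp only [HasPattern, isVertex_subdivision hM, isEndpoint_subdivision hM, pattern,
    Prod.ext_iff, funext_iff, eq_iff_iff]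
  simp only [exists_eq_left, Sum.inl.injEq]

/-- The extension of `A` by `2 * k` vertices with all new multiplicities equal to `k`. -/
def completion (A : Multigraph) (k : ℕ) : Multigraph where
  X := A.X ⊕ Fin (2 * k)
  mult
    | .inl a, .inl b => A.mult a b
    | _, _ => k

theorem extends_completion (A : Multigraph) (k : ℕ) :
    Extends k A (A.completion k) (.inl : A.X → A.X ⊕ Fin (2 * k)) := by
  refine ⟨Sum.inl_injective, fun _ _ => rfl, ?_⟩
  rintro (a | a) (b | b) h
  · rcases h with h | h <;> exact absurd ⟨_, rfl⟩ h
  all_goals exact le_rfl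

theorem room_completion (A : Multigraph) (k : ℕ) :
    Room k A (A.completion k) (.inl : A.X → A.X ⊕ Fin (2 * k)) :=
  ⟨Sum.inr, Sum.inr_injective, fun _ _ => Sum.inr_ne_inl⟩

/-- The tuples of points of the completion that satisfy `φ`. -/
abbrev TrueTuple (A : Multigraph) (φ : InfFormula.{u} k) : Type :=
  {v : Fin k → (A.completion k).Point // φ.Sat (A.completion k).subdivision v}

/-- The extension of `A` by vertices that record the tuples satisfying `φ`, and by `2 * k` further
vertices; all new multiplicities are at least `N`. -/
noncomputable def record (A : Multigraph) (φ : InfFormula.{u} k) (N : ℕ) : Multigraph where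
  X := A.X ⊕ (A.TrueTuple φ ⊕ Fin (2 * k))
  mult
    | .inl a, .inl b => A.mult a b
    | .inr (.inl t), .inl a => N + Label.code (k := k) (some (.inr
        {σ | (A.completion k).endpoint (t.1 σ.1) σ.2 = .inl a}))
    | .inr (.inl t), .inr (.inl _) => N + Label.code (some (.inl ((A.completion k).pattern t.1)))
    | _, _ => N + Label.code (k := k) none

theorem extends_record (A : Multigraph) (φ : InfFormula.{u} k) (N : ℕ) :
    Extends N A (A.record φ N) (.inl : A.X → A.X ⊕ (A.TrueTuple φ ⊕ Fin (2 * k))) := by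
  refine ⟨Sum.inl_injective, fun _ _ => rfl, ?_⟩
  rintro (a | a | a) (b | b | b) h
  · rcases h with h | h <;> exact absurd ⟨_, rfl⟩ h
  all_goals exact Nat.le_add_right _ _

theorem record_mult_lt {N : ℕ} (h : ∀ x y, A.mult x y < N) (φ : InfFormula.{u} k) (x y) :
    (A.record φ N).mult x y < N + Nat.card (Label k) := by
  rcases x with a | a | a <;> rcases y with b | b | b <;>
    first
    | exact (h a b).trans_le (Nat.le_add_right _ _)
    | exact Nat.add_lt_add_left (Label.code_lt _) _

theorem Similar.of_pattern {M' : Multigraph} {f : A.X → M.X} {f' : A.X → M'.X}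
    {v : Fin k → M.Point} {v' : Fin k → M'.Point} (h : M.pattern v = M'.pattern v')
    (hb : ∀ p s a, M.endpoint (v p) s = f a ↔ M'.endpoint (v' p) s = f' a) :
    Similar f f' v v' := by
  simp only [pattern, Prod.ext_iff, funext_iff, eq_iff_iff] at h
  exact ⟨h.1, h.2.1, fun p s q t => h.2.2 (p, s) (q, t), hb⟩

theorem Similar.pattern_eq {M' : Multigraph} {f : A.X → M.X} {f' : A.X → M'.X}
    {v : Fin k → M.Point} {v' : Fin k → M'.Point} (h : Similar f f' v v') :
    M.pattern v = M'.pattern v' := by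
  simp only [pattern, Prod.ext_iff, funext_iff, eq_iff_iff]
  exact ⟨h.eq_iff, h.isLeft_iff, fun σ τ => h.endpoint_iff _ _ _ _⟩

/-- Tuples of distinct fresh vertices are similar in any two extensions; the entries of `v` are then
put in one at a time by the back-and-forth property. -/
theorem exists_similar {M' : Multigraph} {f : A.X → M.X} {f' : A.X → M'.X}
    (hf : Extends k A M f) (hf' : Extends k A M' f') (room : Room k A M f)
    (room' : Room k A M' f') (v : Fin k → M.Point) :
    ∃ v' : Fin k → M'.Point, Similar f f' v v' := by
  obtain ⟨g, hg, hga⟩ := room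
  obtain ⟨g', hg', hga'⟩ := id room'
  let c : Fin k → Fin (2 * k) := Fin.castLE (by omega)
  have key : ∀ s : Finset (Fin k), ∃ v' : Fin k → M'.Point,
      Similar f f' (s.piecewise v fun p => .inl (g (c p))) v' := by
    intro s
    induction s using Finset.induction_on with
    | empty =>
      refine ⟨fun p => .inl (g' (c p)), ?_⟩
      rw [Finset.piecewise_empty]
      exact ⟨fun p q => by simp [hg.eq_iff, hg'.eq_iff], by simp,
        fun p s q t => by simp [endpoint, hg.eq_iff, hg'.eq_iff],
        fun p s a => by simp [endpoint, hga, hga']⟩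
    | insert p s _ ih =>
      obtain ⟨v', hv'⟩ := ih
      obtain ⟨w', hw'⟩ := hv'.exists_update hf hf' room' p (v p)
      exact ⟨_, by rw [Finset.piecewise_insert]; exact hw'⟩
  simpa using key Finset.univ

/-- In an extension of the record of `φ`, the formula `φ` holds exactly for the recorded tuples. -/
theorem sat_iff_isRecorded {φ : InfFormula.{u} k} {N N' : ℕ} (hN : 2 ≤ N) (hkN : k ≤ N)
    (hA : ∀ x y, A.mult x y < N) (hN' : N + Nat.card (Label k) ≤ N')
    (hM : ∀ x y, 2 ≤ M.mult x y) {g : (A.record φ N).X → M.X}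
    (hg : Extends N' (A.record φ N) M g) (v : Fin k → M.Point) :
    φ.Sat M.subdivision v ↔ IsRecorded M.subdivision N v := by
  have hc := A.extends_completion k
  have rc := A.room_completion k
  have hN1 := (A.extends_record φ N).trans hg (by omega)
  have hf := hN1.mono hkN
  set f := g ∘ (.inl : A.X → A.X ⊕ (A.TrueTuple φ ⊕ Fin (2 * k))) with hfdef
  -- The `2 * k` filler vertices of `record` supply the room.
  have rf : Room k A M f := ⟨fun i => g (.inr (.inr i)), fun i j hij =>
    Sum.inr_injective (Sum.inr_injective (hg.injective hij)),
    fun i a h => Sum.inr_ne_inl (hg.injective h)⟩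
  have mult_tt : ∀ t : A.TrueTuple φ, M.mult (g (.inr (.inl t))) (g (.inr (.inl t))) =
      N + Label.code (some (.inl ((A.completion k).pattern t.1))) := fun t => hg.mult_eq _ _
  have mult_ta : ∀ (t : A.TrueTuple φ) a, M.mult (g (.inr (.inl t))) (f a) =
      N + Label.code (k := k) (some (.inr
        {σ | (A.completion k).endpoint (t.1 σ.1) σ.2 = .inl a})) := fun t a => hg.mult_eq _ _
  constructor
  · intro hv
    obtain ⟨u, hu⟩ := exists_similar hf hc rf rc v
    let t : A.TrueTuple φ := ⟨u, (hu.sat_iff hf hc rf rc φ).1 hv⟩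
    refine ⟨.inl (g (.inr (.inl t))), ⟨M.pattern v, (hasPattern_subdivision hM _ _).2 rfl, ?_⟩, ?_⟩
    · rw [hasExactPaths_subdivision, mult_tt, hu.pattern_eq]
    · rintro a ⟨ha, ha'⟩
      rw [isVertex_subdivision hM, Sum.isLeft_iff] at ha
      obtain ⟨x, rfl⟩ := ha
      rw [hasPaths_subdivision] at ha'
      -- Vertices outside `A` carry at least `N` loops, so having fewer singles out the base.
      obtain ⟨b, rfl⟩ : x ∈ Set.range f := by
        by_contra hx
        exact ha' (hN1.le_mult x x (.inl hx))
      refine ⟨{σ | (A.completion k).endpoint (u σ.1) σ.2 = .inl b}, fun σ => ?_, ?_⟩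
      · rw [isEndpoint_subdivision hM, Sum.inl.injEq, eq_comm, hu.base_iff]
        rfl
      · rw [hasExactPaths_subdivision, mult_ta]
  · rintro ⟨x, ⟨π, hπ, hx⟩, hS⟩
    obtain ⟨x, _, rfl, -⟩ := eq_inl_of_hasPaths (by omega) hx.1
    rw [hasExactPaths_subdivision] at hx
    have hlt := Label.code_lt (k := k) (some (.inl π))
    -- A vertex added after the record has at least `N' ≥ N + Nat.card (Label k)` loops, too many
    -- for a label code.
    obtain ⟨b, rfl⟩ : x ∈ Set.range g := by
      by_contra h
      have := hg.le_mult x x (.inl h)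
      omega
    rw [hg.mult_eq] at hx
    rw [hasPattern_subdivision hM] at hπ
    -- A base vertex has fewer than `N` loops and a filler carries the label `none`, so only a
    -- recorded tuple remains. Its loops give the pattern, and its edges into `A` the base
    -- endpoints.
    rcases b with a | t | j
    · have := hA a a
      replace hx : A.mult a a = _ := hx
      omega
    · have hp : (A.completion k).pattern t.1 = π := by
        have := Label.code_inj.1 (Nat.add_left_cancel hx)
        simpa using this
      refine (Similar.sat_iff hc hf rc rf φ (v := t.1)
        (.of_pattern (hp.trans hπ.symm) fun p s a => ?_)).1 t.2
      obtain ⟨S, hS1, hS2⟩ := hS (.inl (f a))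
        ⟨(isVertex_subdivision hM _).2 rfl, by
          rw [hasPaths_subdivision, hN1.mult_eq]
          exact (hA a a).not_ge⟩
      rw [hasExactPaths_subdivision, mult_ta] at hS2
      have := Label.code_inj.1 (Nat.add_left_cancel hS2)
      simp only [Option.some.injEq, Sum.inr.injEq] at this
      have h2 := hS1 (p, s)
      rw [isEndpoint_subdivision hM, Sum.inl.injEq, ← this] at h2
      exact h2.symm.trans eq_comm
    · have := Label.code_inj.1 (Nat.add_left_cancel hx)
      simp at this

end Multigraph

/-! ### An unbounded induction -/

/-- The inclusion of the vocabulary of graphs into its expansion by `P`. -/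
def graphLHom (r : ℕ) : Language.graph →ᴸ indLanguage r where
  onFunction _ f := Empty.elim f
  onRelation | _, .adj => .adj

theorem isExpansionOn_graphLHom {V : Type} (G : Digraph V) {r : ℕ} (R : Set (Fin r → V)) :
    letI := graphStructure G
    letI := indStructure G R
    (graphLHom r).IsExpansionOn V :=
  let _ := graphStructure G
  let _ := indStructure G R
  { map_onFunction := fun f => f.elim
    map_onRelation := fun {n} S x => by cases S; rfl }

/-- Without occurrences of `P` both polarities hold vacuously; the premise of `progressFormula`
needs the negative one. -/
theorem polarity_onBoundedFormula {r : ℕ} {α : Type} {n : ℕ}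
    (φ : Language.graph.BoundedFormula α n) (b : Bool) :
    Polarity b ((graphLHom r).onBoundedFormula φ) := by
  induction φ generalizing b with
  | falsum => trivial
  | equal => trivial
  | rel S ts => cases S; exact fun h => h.elim
  | imp φ ψ ih₁ ih₂ => exact ⟨ih₁ _, ih₂ _⟩
  | all φ ih => exact ih _

/-- The formula `∀ w, χ(w, v) → P(w)`. -/
def progressFormula (χ : Language.graph.Formula (Fin 2)) :
    (indLanguage 1).Formula (Fin 1 ⊕ Fin 0) :=
  let ξ : Language.graph.BoundedFormula (Fin 1 ⊕ Fin 0) 1 :=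
    -- Variable 0 of `χ` becomes the bound `w`, variable 1 the induction variable `v`.
    Language.BoundedFormula.relabel (n := 1) (k := 0) ![.inr 0, .inl (.inl 0)] χ
  .all (.imp ((graphLHom 1).onBoundedFormula ξ) (.rel IndRel.P fun _ => .var (.inr 0)))

/-- The induction that adds `v` to `P` once `P` contains all `w` with `χ(w, v)`. -/
def wellFoundedPart (χ : Language.graph.Formula (Fin 2)) : PosInduction where
  r := 1
  p := 0
  formula := progressFormula χ
  positive := ⟨polarity_onBoundedFormula _ _, fun _ => rfl⟩

theorem realize_progressFormula (χ : Language.graph.Formula (Fin 2)) {V : Type} (G : Digraph V)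
    (S : Set (Fin 1 → V)) (v : Fin 1 → V) (a : Fin 0 → V) :
    letI := indStructure G S
    (progressFormula χ).Realize (Sum.elim v a) ↔ ∀ w, FOSat G χ ![w, v 0] → (fun _ => w) ∈ S := by
  let _ := graphStructure G
  let _ := indStructure G S
  have := isExpansionOn_graphLHom G S
  refine forall_congr' fun w => imp_congr ?_ Iff.rfl
  refine (Language.LHom.realize_onBoundedFormula _ _).trans
    (Language.BoundedFormula.realize_relabel.trans ?_)
  refine iff_of_eq (congrArg₂ _ ?_ (Subsingleton.elim _ _))
  ext p
  fin_cases p <;> simp [Fin.snoc]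

theorem mem_wellFoundedPart_stage_succ (χ : Language.graph.Formula (Fin 2)) {V : Type}
    (G : Digraph V) (a : Fin 0 → V) (i : ℕ) (v : Fin 1 → V) :
    v ∈ (wellFoundedPart χ).stage G a (i + 1) ↔
      ∀ w, FOSat G χ ![w, v 0] → (fun _ => w) ∈ (wellFoundedPart χ).stage G a i :=
  realize_progressFormula χ G _ v a

/-! ### The construction -/

namespace Multigraph

/-- The vertices `0, …, n`, with three edges from each of them to its successor and two edges
between all other pairs. -/
def path (n : ℕ) : Multigraph where
  X := Fin (n + 1)
  mult a b := if a.val + 1 = b.val then 3 else 2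

/-- A lower bound for the multiplicities that record the `i`-th formula. -/
noncomputable def threshold (F : ℕ → InfinitaryFormula.{u}) : ℕ → ℕ
  | 0 => 4 + (F 0).1
  | i + 1 => threshold F i + Nat.card (Label (F i).1) + (F (i + 1)).1

/-- The multigraph obtained from a path by recording the first `i` formulas. -/
noncomputable def tower (F : ℕ → InfinitaryFormula.{u}) (n : ℕ) : ℕ → Multigraph
  | 0 => path n
  | i + 1 => (tower F n i).record (F i).2 (threshold F i)

variable (F : ℕ → InfinitaryFormula.{u}) (n : ℕ)

theorem le_threshold (i : ℕ) : (F i).1 ≤ threshold F i := by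
  cases i <;> simp [threshold]

theorem threshold_mono : Monotone (threshold F) :=
  monotone_nat_of_le_succ fun i => by rw [threshold, add_assoc]; exact Nat.le_add_right _ _

/-- Path multiplicities are 2 and 3, so every multiplicity involving a recording vertex avoids 3. -/
theorem four_le_threshold (i : ℕ) : 4 ≤ threshold F i :=
  (Nat.le_add_right _ _).trans (threshold_mono F i.zero_le)

/-- The codes of stage `i` end before `threshold F (i + 1)`, so different stages use disjoint ranges
of multiplicities. -/
theorem tower_mult_lt (i : ℕ) (x y) : (tower F n i).mult x y < threshold F i := by
  induction i with
  | zero =>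
    have := four_le_threshold F 0
    change (if x.val + 1 = y.val then 3 else 2) < _
    split_ifs <;> omega
  | succ i ih => exact (record_mult_lt ih _ x y).trans_le (Nat.le_add_right _ _)

theorem exists_extends_tower {i j : ℕ} (h : i ≤ j) :
    ∃ f, Extends (threshold F i) (tower F n i) (tower F n j) f := by
  induction j, h using Nat.le_induction with
  | base => exact ⟨id, .refl _ _⟩
  | succ j hj ih =>
    obtain ⟨f, hf⟩ := ih
    exact ⟨_, hf.trans (extends_record _ _ _) (threshold_mono F hj)⟩

theorem two_le_tower_mult (i : ℕ) (x y) : 2 ≤ (tower F n i).mult x y := by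
  obtain ⟨f, hf⟩ := exists_extends_tower F n i.zero_le
  by_cases h : x ∉ Set.range f ∨ y ∉ Set.range f
  · have := hf.le_mult x y h
    have := four_le_threshold F 0
    omega
  · push Not at h
    obtain ⟨⟨a, rfl⟩, ⟨b, rfl⟩⟩ := h
    rw [hf.mult_eq]
    change 2 ≤ (if a.val + 1 = b.val then 3 else 2)
    split_ifs <;> omega

theorem tower_sat_iff {i : ℕ} (h : i < n) (v : Fin (F i).1 → (tower F n n).Point) :
    (F i).2.Sat (tower F n n).subdivision v ↔
      IsRecorded (tower F n n).subdivision (threshold F i) v := by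
  obtain ⟨g, hg⟩ := exists_extends_tower F n (Nat.succ_le_of_lt h)
  exact sat_iff_isRecorded (by have := four_le_threshold F i; omega) (le_threshold F i)
    (tower_mult_lt F n i) (Nat.le_add_right _ _) (two_le_tower_mult F n n) hg v

/-- Only path edges have multiplicity exactly 3, so the path's successor relation survives all
recording steps and no other vertex precedes a path vertex. -/
theorem exists_path_embedding : ∃ f : Fin (n + 1) → (tower F n n).X, ∀ (z : (tower F n n).Point) b,
    HasExactPaths (tower F n n).subdivision 3 z (.inl (f b)) ↔
      ∃ a : Fin (n + 1), a.val + 1 = b.val ∧ z = .inl (f a) := by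
  obtain ⟨f, hf⟩ := exists_extends_tower F n n.zero_le
  have hm : ∀ a b : Fin (n + 1), (tower F n n).mult (f a) (f b) =
      if a.val + 1 = b.val then 3 else 2 := hf.mult_eq
  refine ⟨f, fun z b => ⟨fun h => ?_, ?_⟩⟩
  · obtain ⟨x, _, rfl, -⟩ := eq_inl_of_hasPaths (by norm_num) h.1
    rw [hasExactPaths_subdivision] at h
    obtain ⟨a, rfl⟩ : ∃ a : Fin (n + 1), f a = x := by
      by_contra hx
      have := hf.le_mult x (f b) (.inl hx)
      have := four_le_threshold F 0
      omega
    rw [hm] at h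
    refine ⟨a, ?_, rfl⟩
    by_contra hab
    simp [hab] at h
  · rintro ⟨a, hab, rfl⟩
    rw [hasExactPaths_subdivision, hm, if_pos hab]

/-- The `n`-th graph of the construction. -/
noncomputable def towerGraph : FinDigraph where
  V := (tower F n n).Point
  nonempty :=
    let ⟨f, _⟩ := exists_path_embedding F n
    ⟨.inl (f 0)⟩
  graph := (tower F n n).subdivision
  loopless := by rintro (x | e) h <;> exact h

theorem unboundedFixedPoints_towerGraph :
    AdmitsUnboundedFixedPoints (isoClosure (Set.range (towerGraph F))) := by
  obtain ⟨χ, hχ⟩ := FODefinable.hasExactPaths 3 (0 : Fin 2) 1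
  refine ⟨wellFoundedPart χ, fun ⟨j, hj⟩ => ?_⟩
  obtain ⟨f, hf⟩ := exists_path_embedding F j
  -- The vertex `b` enters at stage `b + 1` exactly, so the last vertex `j` is still missing at the
  -- supposed bound `j`.
  have mem_stage : ∀ i (b : Fin (j + 1)), (fun _ => .inl (f b)) ∈
      (wellFoundedPart χ).stage (tower F j j).subdivision Fin.elim0 i ↔ b.val < i := by
    intro i
    induction i with
    | zero => exact fun b => iff_of_false (fun h => h) (Nat.not_lt_zero _)
    | succ i ih =>
      intro b
      refine (mem_wellFoundedPart_stage_succ χ _ _ _ _).trans ?_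
      simp only [← hχ, Matrix.cons_val_zero, Matrix.cons_val_one, hf]
      constructor
      · intro h
        by_contra hb
        have hlt := b.isLt
        have := (ih ⟨b - 1, by omega⟩).1 (h _ ⟨⟨b - 1, by omega⟩, by simp only []; omega, rfl⟩)
        simp only [] at this
        omega
      · rintro hb w ⟨a, hab, rfl⟩
        exact (ih a).2 (by omega)
  have heq := hj (towerGraph F j) ⟨_, ⟨j, rfl⟩, ⟨RelIso.refl _⟩⟩ Fin.elim0
  have h1 := (mem_stage (j + 1) (Fin.last j)).2 (by simp)
  have h2 : _ ∈ ⋃ i, (wellFoundedPart χ).stage (tower F j j).subdivision Fin.elim0 i :=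
    Set.mem_iUnion.2 ⟨j + 1, h1⟩
  have h3 := (mem_stage j (Fin.last j)).1 (heq.symm.subset h2)
  simp at h3

end Multigraph

end McColm

theorem mainTheorem2 (L : Set McColm.InfinitaryFormula.{u}) (hL : L.Countable) :
    ∃ K : Set McColm.FinDigraph, McColm.IsoClosed K ∧ McColm.AdmitsUnboundedFixedPoints K ∧
      ∀ φ ∈ L, McColm.EquivFirstOrder K φ := by
  -- The empty conjunction is a formula, so even an empty `L` lies in the range of a sequence.
  have : Nonempty McColm.InfinitaryFormula.{u} := ⟨⟨0, .conj PEmpty.elim⟩⟩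
  obtain ⟨F, hF⟩ := Set.countable_iff_exists_subset_range.1 hL
  refine ⟨McColm.isoClosure (Set.range (McColm.Multigraph.towerGraph F)),
    McColm.isoClosed_isoClosure _, McColm.Multigraph.unboundedFixedPoints_towerGraph F, ?_⟩
  intro φ hφ
  obtain ⟨i, rfl⟩ := hF hφ
  exact McColm.equivFirstOrder_of_forall_gt _ _ i (McColm.FODefinable.isRecorded _ _)
    fun n hn v => McColm.Multigraph.tower_sat_iff F n hn v
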